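/- Let $2^\omega$ be the Cantor space with the product topology and let $\mathcal H(2^\omega)$ be the group of its homeomorphisms onto itself, under composition. Let $Q\subseteq 2^\omega$ be the set of eventually constant sequences. For a subgroup $\mathcal S$ of $\mathcal H(2^\omega)$, $A\subseteq 2^\omega$ and $x\in 2^\omega$ write $\mathcal S[A]=\bigcup_{h\in\mathcal S}h[A]$ and $\mathcal S(x)=\mathcal S[\{x\}]$. Let $\mathfrak c=2^{\aleph_0}$, and let $\mathsf{add(meager)}$ be the least cardinality of a collection of meager subsets of $2^\omega$ whose union is not meager in $2^\omega$. A space is rigid if the identity is its only homeomorphism onto itself. Let $X$ be a subspace of $2^\omega$, let $Y=2^\omega\setminus X$, let $\mathcal H$ be a subgroup of $\mathcal H(2^\omega)$, and let $D$ be a countable dense subset of $2^\omega$ such that $D\subseteq Y$ and $D\cap Q=\varnothing$. Let $\mathcal G$ be the collection of all homeomorphisms $g$ such that $\mathrm{dom}(g)$ and $\mathrm{ran}(g)$ are $G_\delta$ subspaces of $2^\omega$. Assume that the following conditions hold. 1. $\mathcal H[X]=X$. 2. If $h\in\mathcal H\setminus\{\mathrm{id}\}$, then $h[D]\cap D=\varnothing$.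 3. If $g\in\mathcal G$ and $|\{x\in\mathrm{dom}(g): g(x)\notin\mathcal S(x)\}|=\mathfrak c$ for every subgroup $\mathcal S$ of $\mathcal H$ such that $|\mathcal S|<\mathsf{add(meager)}$, then there exists $z\in\mathrm{dom}(g)\cap X$ such that $g(z)\notin X$. Then there exists a subspace $X^\ast$ of $2^\omega$, homeomorphic to $X$, such that $2^\omega\setminus X^\ast$ is dense in $2^\omega$ and rigid. -/

import Mathlib

namespace RigidComplement

/-- The Cantor space `2^ω`, with the product topology. -/
abbrev Cantor : Type := ℕ → Bool

/-- The set of eventually constant sequences. -/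
def Q : Set Cantor := {x | ∃ m : ℕ, ∀ n : ℕ, m ≤ n → x n = x m}

/-- `H[X] = ⋃_{h ∈ H} h[X]`, for a subgroup `H` of the homeomorphism group of `Z` and `X ⊆ Z`
(the group operation on `Z ≃ₜ Z` is composition). -/
def groupImage {Z : Type*} [TopologicalSpace Z] (H : Subgroup (Z ≃ₜ Z)) (X : Set Z) : Set Z :=
  ⋃ h ∈ H, h '' X

/-- `H(x) = H[{x}]`. -/
def groupOrbit {Z : Type*} [TopologicalSpace Z] (H : Subgroup (Z ≃ₜ Z)) (x : Z) : Set Z :=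
  groupImage H {x}

/-- `add(meager)`: the least cardinality of a collection of meager subsets of `2^ω` whose union is
not meager. -/
noncomputable def addMeager : Cardinal.{0} :=
  sInf {κ | ∃ C : Set (Set Cantor),
    Cardinal.mk C = κ ∧ (∀ A ∈ C, IsMeagre A) ∧ ¬ IsMeagre (⋃₀ C)}

/-- A space is rigid if the identity is its only homeomorphism onto itself. -/
def IsRigid (X : Type*) [TopologicalSpace X] : Prop :=
  ∀ f : X ≃ₜ X, f = Homeomorph.refl X

end RigidComplement

/-! Split every point of `D`: take the closure of the graph of the map recording on which side of
each d ∈ D a point lies. By Brouwer's theorem the result is again a Cantor space, and its projection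
π to the old one is one-to-one off `D` but has nontrivial fibres over `D`. Since `D` misses `X`, the
set π⁻¹(X) is a copy of `X`.

Let f ≠ id be a homeomorphism of Y* = 2^ω \ π⁻¹(X). Closing its graph, as in Lavrentieff's theorem,
and projecting by π gives a homeomorphism g between comeager G_δ subsets of the base. It never leads
out of `X`, because f⁻¹ maps Y* into itself. So condition 3 yields a subgroup S with |S| <
add(meager) such that g(x) ∈ S(x) with fewer than 𝔠 exceptions. By Baire category g agrees with one
h ∈ S on a nonempty open set V, which can be placed where f moves points, so h ≠ id. Taking limits,
f maps the fibre over d ∈ D ∩ V into the fibre over h(d), a single point by condition 2. But the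
fibre over d has two points, both in Y*, and f is injective. -/

namespace RigidComplement

open Set Filter Topology

/-! ### Brouwer's characterization of the Cantor space -/

section Brouwer

variable {K : Type*} (c : ℕ → K → Bool)

/-- The least index of a function of the family that is not constant on `S`. -/
noncomputable def splitIndex (S : Set K) : ℕ :=
  sInf {m | ∃ x ∈ S, ∃ y ∈ S, c m x ≠ c m y}

/-- The cells of the tree obtained by repeatedly splitting a cell along the first function
of the family that is not constant on it. -/
noncomputable def cell : List Bool → Set K
  | [] => univ
  | b :: l => cell l ∩ {x | c (splitIndex c (cell l)) x = b}

/-- The first `n` choices on the branch of `x`, latest choice first. -/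
noncomputable def branch (x : K) : ℕ → List Bool
  | 0 => []
  | n + 1 => c (splitIndex c (cell c (branch x n))) x :: branch x n

theorem length_branch (x : K) (n : ℕ) : (branch c x n).length = n := by
  induction n with
  | zero => rfl
  | succ n ih => simp [branch, ih]

theorem mem_cell_branch (x : K) (n : ℕ) : x ∈ cell c (branch c x n) := by
  induction n with
  | zero => trivial
  | succ n ih => exact ⟨ih, rfl⟩

theorem branch_eq_of_mem_cell {x y : K} {n : ℕ} (h : y ∈ cell c (branch c x n)) :
    branch c y n = branch c x n := by
  induction n with
  | zero => rfl
  | succ n ih =>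
    have h1 := ih h.1
    have h2 : c (splitIndex c (cell c (branch c x n))) y = _ := h.2
    simp only [branch, h1, h2]

/-- Each split uses the least index that is not constant, so by induction a cell of depth n has `c
0, …, c (n - 1)` constant. Hence a branch determines its point. -/
theorem eq_on_cell {l : List Bool} {j : ℕ} (hj : j < l.length) {x y : K}
    (hx : x ∈ cell c l) (hy : y ∈ cell c l) : c j x = c j y := by
  induction l generalizing j x y with
  | nil => simp at hj
  | cons b l ih =>
    rcases Nat.lt_or_ge j l.length with h | h
    · exact ih h hx.1 hy.1
    have hjl : j = l.length := by simp at hj; omega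
    by_contra hne
    have hle : splitIndex c (cell c l) ≤ j := Nat.sInf_le ⟨x, hx.1, y, hy.1, hne⟩
    rcases hle.lt_or_eq with hlt | heq
    · obtain ⟨u, hu, v, hv, huv⟩ : splitIndex c (cell c l) ∈
          {m | ∃ x ∈ cell c l, ∃ y ∈ cell c l, c m x ≠ c m y} :=
        Nat.sInf_mem ⟨j, x, hx.1, y, hy.1, hne⟩
      exact huv (ih (hjl ▸ hlt) hu hv)
    · have h1 : c (splitIndex c (cell c l)) x = b := hx.2
      have h2 : c (splitIndex c (cell c l)) y = b := hy.2
      rw [heq] at h1 h2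
      exact hne (h1.trans h2.symm)

variable [TopologicalSpace K] {c}

theorem isClopen_cell (hc : ∀ n, Continuous (c n)) (l : List Bool) : IsClopen (cell c l) := by
  induction l with
  | nil => exact isClopen_univ
  | cons b l ih => exact ih.inter ((isClopen_discrete {b}).preimage (hc _))

/-- A nonempty open cell has two points and some `c m` tells them apart, so `splitIndex` is an
attained minimum, not the default `sInf ∅ = 0`, and both values occur on the cell. -/
theorem nonempty_cell [Nonempty K] (hc : ∀ n, Continuous (c n))
    (sep : ∀ x y, (∀ n, c n x = c n y) → x = y)
    (crowded : ∀ U : Set K, IsOpen U → U.Nonempty → U.Nontrivial) (l : List Bool) :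
    (cell c l).Nonempty := by
  induction l with
  | nil => exact univ_nonempty
  | cons b l ih =>
    obtain ⟨x, hx, y, hy, hxy⟩ := crowded _ (isClopen_cell hc l).isOpen ih
    obtain ⟨m, hm⟩ : ∃ m, c m x ≠ c m y := by
      by_contra! h
      exact hxy (sep x y h)
    obtain ⟨u, hu, v, hv, huv⟩ : splitIndex c (cell c l) ∈
        {m | ∃ x ∈ cell c l, ∃ y ∈ cell c l, c m x ≠ c m y} :=
      Nat.sInf_mem ⟨m, x, hx, y, hy, hm⟩
    by_cases hb : c (splitIndex c (cell c l)) u = b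
    · exact ⟨u, hu, hb⟩
    · refine ⟨v, hv, ?_⟩
      change c (splitIndex c (cell c l)) v = b
      revert huv hb
      generalize c (splitIndex c (cell c l)) u = p
      generalize c (splitIndex c (cell c l)) v = q
      revert p q b
      decide

/-- **Brouwer's characterization of the Cantor space**: a nonempty compact space without isolated
points whose points are separated by countably many clopen sets is homeomorphic to it. -/
theorem nonempty_homeomorph_cantor [CompactSpace K] [Nonempty K] (hc : ∀ n, Continuous (c n))
    (sep : ∀ x y, (∀ n, c n x = c n y) → x = y)
    (crowded : ∀ U : Set K, IsOpen U → U.Nonempty → U.Nontrivial) :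
    Nonempty (K ≃ₜ Cantor) := by
  let φ : K → Cantor := fun x n => c (splitIndex c (cell c (branch c x n))) x
  have hbranch : ∀ x n, branch c x (n + 1) = φ x n :: branch c x n := fun _ _ => rfl
  have hcont : Continuous φ := by
    refine continuous_pi fun n => ?_
    refine ((IsLocallyConstant.iff_exists_open _).2 fun x => ⟨cell c (branch c x (n + 1)),
      (isClopen_cell hc _).isOpen, mem_cell_branch c x _, fun y hy => ?_⟩).continuous
    have := branch_eq_of_mem_cell c hy
    rw [hbranch, hbranch] at this
    exact (List.cons.inj this).1
  have hinj : Function.Injective φ := by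
    intro x y hxy
    have hb : ∀ n, branch c x n = branch c y n := by
      intro n
      induction n with
      | zero => rfl
      | succ n ih => rw [hbranch, hbranch, ih, hxy]
    refine sep x y fun n => eq_on_cell c (l := branch c x (n + 1)) ?_ (mem_cell_branch c x _) ?_
    · rw [length_branch]; omega
    · rw [hb]; exact mem_cell_branch c y _
  have hsurj : Function.Surjective φ := by
    intro b
    let p : ℕ → List Bool := fun n => Nat.rec [] (fun k l => b k :: l) n
    have hp : ∀ n, p (n + 1) = b n :: p n := fun _ => rfl
    obtain ⟨x, hx⟩ := IsCompact.nonempty_iInter_of_sequence_nonempty_isCompact_isClosed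
      (fun n => cell c (p n)) (fun n => by
        simp only [hp]; exact inter_subset_left)
      (fun n => nonempty_cell hc sep crowded _) isCompact_univ
      (fun n => (isClopen_cell hc _).isClosed)
    rw [mem_iInter] at hx
    have hbr : ∀ n, branch c x n = p n := by
      intro n
      induction n with
      | zero => rfl
      | succ n ih =>
        have h : c (splitIndex c (cell c (p n))) x = b n := (hx (n + 1)).2
        rw [hp, branch, ih, h]
    refine ⟨x, funext fun n => ?_⟩
    have h : c (splitIndex c (cell c (p n))) x = b n := (hx (n + 1)).2
    simp only [φ, hbr, h]
  exact ⟨hcont.homeoOfEquivCompactToT2 (f := Equiv.ofBijective φ ⟨hinj, hsurj⟩)⟩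

end Brouwer

/-! ### Splitting the points of a countable set -/

theorem eq_of_mem_closure_range_of_tendsto {ι E F : Type*} [TopologicalSpace E]
    [TopologicalSpace F] [T2Space F] {u : ι → E} {v : ι → F} {x : E} {y l : F}
    (h : (x, y) ∈ closure (range fun i => (u i, v i)))
    (hv : Tendsto v (comap u (𝓝 x)) (𝓝 l)) : y = l := by
  have hne : (comap (fun i => (u i, v i)) (𝓝 (x, y))).NeBot := by
    refine comap_neBot fun t ht => ?_
    obtain ⟨_, hp, i, rfl⟩ := mem_closure_iff_nhds.1 h t ht
    exact ⟨i, hp⟩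
  have ht : Tendsto (fun i => (u i, v i)) (comap (fun i => (u i, v i)) (𝓝 (x, y))) (𝓝 (x, y)) :=
    tendsto_comap
  exact tendsto_nhds_unique ht.snd_nhds (hv.mono_left (tendsto_iff_comap.1 ht.fst_nhds))

instance cantor_neBot_nhdsNE (x : Cantor) : (𝓝[≠] x).NeBot := by
  have h : Tendsto (fun n => Function.update x n (!x n)) atTop (𝓝 x) := by
    refine tendsto_pi_nhds.2 fun i => tendsto_const_nhds.congr' ?_
    filter_upwards [eventually_gt_atTop i] with n hn
    rw [Function.update_of_ne hn.ne]
  refine (tendsto_nhdsWithin_of_tendsto_nhds_of_eventually_within _ h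
    (Eventually.of_forall fun n => ?_)).neBot
  intro hn
  have := congrFun (show Function.update x n (!x n) = x from hn) n
  simp at this

theorem isMeagre_of_countable {D : Set Cantor} (hD : D.Countable) : IsMeagre D := by
  rw [← biUnion_of_singleton D]
  refine isMeagre_biUnion hD fun x _ => IsNowhereDense.isMeagre ?_
  rw [isClosed_singleton.isNowhereDense_iff, interior_singleton]

theorem dense_compl_of_countable {D : Set Cantor} (hD : D.Countable) : Dense Dᶜ :=
  dense_of_mem_residual (isMeagre_of_countable hD)

/-- The parity of the first place at which `d` and `x` differ. -/
noncomputable def side (d x : Cantor) : Bool := (PiNat.firstDiff d x).bodd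

theorem firstDiff_eq {d x : Cantor} {k : ℕ} (h : ∀ i < k, x i = d i) (hk : x k ≠ d k) :
    PiNat.firstDiff d x = k := by
  have hne : d ≠ x := fun e => hk (by rw [e])
  rcases lt_trichotomy (PiNat.firstDiff d x) k with hlt | heq | hgt
  · exact absurd (h _ hlt).symm (PiNat.apply_firstDiff_ne hne)
  · exact heq
  · exact absurd (PiNat.apply_eq_of_lt_firstDiff hgt).symm hk

theorem isOpen_cylinder (x : Cantor) (n : ℕ) : IsOpen {y : Cantor | ∀ i < n, y i = x i} := by
  have : {y : Cantor | ∀ i < n, y i = x i} = ⋂ i ∈ Iio n, (fun y : Cantor => y i) ⁻¹' {x i} := by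
    ext; simp
  rw [this]
  exact (finite_Iio n).isOpen_biInter fun i _ => (isOpen_discrete _).preimage (continuous_apply i)

theorem continuousAt_side {d x : Cantor} (h : x ≠ d) : ContinuousAt (side d) x := by
  refine continuousAt_const.congr (f := fun _ => side d x) ?_
  filter_upwards [(isOpen_cylinder x (PiNat.firstDiff d x + 1)).mem_nhds (fun _ _ => rfl)]
    with y hy
  unfold side
  rw [firstDiff_eq (x := y) (k := PiNat.firstDiff d x)]
  · intro i hi
    rw [hy i (by omega), PiNat.apply_eq_of_lt_firstDiff hi]
  · rw [hy _ (by omega)]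
    exact (PiNat.apply_firstDiff_ne h.symm).symm

/-- Points that first differ from `d` at place k tend to `d` as k grows, and the parity of k is
free. -/
theorem mem_closure_side (d : Cantor) (b : Bool) {W : Set Cantor} (hW : Dense W) :
    d ∈ closure {x ∈ W | side d x = b} := by
  refine mem_closure_iff.2 fun U hU hd => ?_
  have ht : Tendsto (fun n => Function.update d n (!d n)) atTop (𝓝 d) := by
    refine tendsto_pi_nhds.2 fun i => tendsto_const_nhds.congr' ?_
    filter_upwards [eventually_gt_atTop i] with n hn
    rw [Function.update_of_ne hn.ne]
  obtain ⟨N, hN⟩ := eventually_atTop.1 (ht (hU.mem_nhds hd))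
  obtain ⟨k, hkN, hkb⟩ : ∃ k ≥ N, k.bodd = b := by
    cases b
    · exact ⟨2 * N, by omega, by simp⟩
    · exact ⟨2 * N + 1, by omega, by simp⟩
  obtain ⟨x, ⟨hxU, hx⟩, hxW⟩ := hW.inter_open_nonempty
    (U ∩ {y | ∀ i < k + 1, y i = Function.update d k (!d k) i})
    (hU.inter (isOpen_cylinder _ _)) ⟨_, hN k hkN, fun _ _ => rfl⟩
  refine ⟨x, hxU, hxW, ?_⟩
  rw [side, firstDiff_eq (k := k), hkb]
  · intro i hi
    rw [hx i (by omega), Function.update_of_ne hi.ne]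
  · rw [hx k (by omega)]
    simp

/-- Every point of a countable subset of the Cantor space can be split, the result being again the
Cantor space. -/
theorem exists_splitting {D : Set Cantor} (hD : D.Countable) :
    ∃ π : Cantor → Cantor, Continuous π ∧ Function.Surjective π ∧
      (∀ x y, π x = π y → π x ∉ D → x = y) ∧
      (∀ d ∈ D, ∃ x y, x ≠ y ∧ π x = d ∧ π y = d) ∧ Dense (π ⁻¹' Dᶜ) := by
  rcases D.eq_empty_or_nonempty with rfl | hne
  · exact ⟨id, continuous_id, Function.surjective_id, fun _ _ h _ => h, by simp, by simp⟩
  obtain ⟨d, rfl⟩ := hD.exists_eq_range hne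
  set W : Set Cantor := (range d)ᶜ
  have hW : Dense W := dense_compl_of_countable hD
  let φ : Cantor → Cantor := fun x n => side (d n) x
  have hφ : ∀ x ∈ W, ContinuousAt φ x := fun x hx =>
    continuousAt_pi.2 fun n => continuousAt_side fun e => hx ⟨n, e.symm⟩
  -- Over `W` the map `φ` is continuous, so the closure adds no point there; over `d n` it keeps the
  -- limits from both sides apart.
  let K : Set (Cantor × Cantor) := closure (range fun w : W => ((w : Cantor), φ w))
  have hKc : IsCompact K := isClosed_closure.isCompact
  have hmem : ∀ w ∈ W, (w, φ w) ∈ K := fun w hw => subset_closure ⟨⟨w, hw⟩, rfl⟩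
  have huniq : ∀ x ∈ W, ∀ y, (x, y) ∈ K → y = φ x := fun x hx y hxy =>
    eq_of_mem_closure_range_of_tendsto hxy ((hφ x hx).tendsto.comp tendsto_comap)
  have hdenseK : ∀ U : Set K, IsOpen U → U.Nonempty → ∃ w, ∃ hw : w ∈ W,
      (⟨(w, φ w), hmem w hw⟩ : K) ∈ U := by
    rintro _ ⟨V, hV, rfl⟩ ⟨p, hp⟩
    obtain ⟨_, hq, ⟨w, rfl⟩⟩ := mem_closure_iff.1 p.2 V hV hp
    exact ⟨w, w.2, hq⟩
  have : CompactSpace K := isCompact_iff_compactSpace.1 hKc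
  obtain ⟨w₀, hw₀⟩ := hW.nonempty
  have : Nonempty K := ⟨⟨_, hmem w₀ hw₀⟩⟩
  obtain ⟨e⟩ : Nonempty (K ≃ₜ Cantor) := by
    refine nonempty_homeomorph_cantor
      (c := fun n p => Sum.elim p.1.1 p.1.2 (Equiv.natSumNatEquivNat.symm n)) ?_ ?_ ?_
    · intro n
      rcases Equiv.natSumNatEquivNat.symm n with i | i
      · exact (continuous_apply i).comp (continuous_fst.comp continuous_subtype_val)
      · exact (continuous_apply i).comp (continuous_snd.comp continuous_subtype_val)
    · intro p q h
      refine Subtype.ext (Prod.ext (funext fun i => ?_) (funext fun i => ?_))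
      · simpa only [Equiv.symm_apply_apply, Sum.elim_inl, Sum.elim_inr] using h (Equiv.natSumNatEquivNat (.inl i))
      · simpa only [Equiv.symm_apply_apply, Sum.elim_inl, Sum.elim_inr] using h (Equiv.natSumNatEquivNat (.inr i))
    · rintro U hU hUne
      obtain ⟨w, hw, hwU⟩ := hdenseK U hU hUne
      obtain ⟨V, hV, rfl⟩ := hU
      have hnhds : (fun x => (x, φ x)) ⁻¹' V ∈ 𝓝 w :=
        (continuousAt_id.prodMk (hφ w hw)).preimage_mem_nhds (hV.mem_nhds hwU)
      have hdense : Dense (insert w (range d))ᶜ := dense_compl_of_countable (hD.insert w)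
      obtain ⟨w', hw', hw'V⟩ := hdense.inter_nhds_nonempty hnhds
      rw [mem_compl_iff, mem_insert_iff, not_or] at hw'
      refine ⟨_, hwU, ⟨(w', φ w'), hmem w' hw'.2⟩, hw'V, fun h => hw'.1 ?_⟩
      exact (congrArg (fun p : K => p.1.1) h).symm
  have hfst : Continuous fun p : K => p.1.1 := continuous_fst.comp continuous_subtype_val
  have hover : ∀ n b, ∃ p : K, p.1.1 = d n ∧ p.1.2 n = b := by
    intro n b
    -- The slice with n-th side `b` has a closed projection containing all points of `W` on that
    -- side of `d n`, and these accumulate at `d n`.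
    have hcl : IsClosed (Prod.fst '' (K ∩ {p | p.2 n = b})) := by
      refine ((hKc.inter_right ?_).image continuous_fst).isClosed
      exact isClosed_eq ((continuous_apply n).comp continuous_snd) continuous_const
    have hsub : {x ∈ W | side (d n) x = b} ⊆ Prod.fst '' (K ∩ {p | p.2 n = b}) :=
      fun x hx => ⟨(x, φ x), ⟨hmem x hx.1, hx.2⟩, rfl⟩
    obtain ⟨p, ⟨hpK, hp⟩, h⟩ := closure_minimal hsub hcl (mem_closure_side (d n) b hW)
    exact ⟨⟨p, hpK⟩, h, hp⟩
  refine ⟨fun x => (e.symm x).1.1, hfst.comp e.symm.continuous, ?_, ?_, ?_, ?_⟩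
  · refine Function.Surjective.comp (g := fun p : K => p.1.1) ?_ e.symm.surjective
    have hcl : IsClosed (range fun p : K => p.1.1) := (isCompact_range hfst).isClosed
    refine range_eq_univ.1 (eq_univ_of_univ_subset ?_)
    rw [← hW.closure_eq]
    exact closure_minimal (fun w hw => ⟨⟨_, hmem w hw⟩, rfl⟩) hcl
  · intro x y hxy hx
    refine e.symm.injective (Subtype.ext (Prod.ext hxy ?_))
    change (e.symm x).1.1 = (e.symm y).1.1 at hxy
    change (e.symm x).1.1 ∈ W at hx
    have h1 := huniq _ hx _ (e.symm x).2
    have h2 := huniq _ (hxy ▸ hx) _ (e.symm y).2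
    rw [h1, h2, hxy]
  · rintro _ ⟨n, rfl⟩
    obtain ⟨p, hp, hpb⟩ := hover n true
    obtain ⟨q, hq, hqb⟩ := hover n false
    refine ⟨e p, e q, fun h => ?_, by simpa using hp, by simpa using hq⟩
    rw [e.injective h, hqb] at hpb
    exact absurd hpb (by decide)
  · refine dense_iff_inter_open.2 fun U hU hUne => ?_
    obtain ⟨w, hw, hwU⟩ := hdenseK (e ⁻¹' U) (hU.preimage e.continuous)
      (hUne.preimage e.surjective)
    exact ⟨_, hwU, by simpa using hw⟩

/-! ### Closed relations and σ-compact sets -/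

theorem continuous_of_isClosed_relation {Z : Type*} [TopologicalSpace Z] [CompactSpace Z]
    {A : Set Z} {R : Set (Z × Z)} (hR : IsClosed R) {f : A → Z}
    (hf : ∀ (z : A) (w : Z), ((z : Z), w) ∈ R ↔ w = f z) : Continuous f := by
  refine continuous_iff_isClosed.2 fun C hC => ?_
  have : f ⁻¹' C = Subtype.val ⁻¹' (Prod.fst '' (R ∩ Prod.snd ⁻¹' C)) := by
    ext z
    constructor
    · exact fun h => ⟨(z, f z), ⟨(hf z _).2 rfl, h⟩, rfl⟩
    · rintro ⟨⟨z', w⟩, ⟨hzw, hw⟩, rfl : z' = z⟩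
      rw [mem_preimage, ← (hf z w).1 hzw]
      exact hw
  rw [this]
  exact (isClosedMap_fst_of_compactSpace _ (hR.inter (hC.preimage continuous_snd))).preimage
    continuous_subtype_val

/-- Continuity in both directions comes from closedness of `R` and compactness of `Z`. Partners must
be unique in all of `Z`, since the projection argument ranges over `Z`. -/
theorem exists_homeomorph_of_isClosed_relation {Z : Type*} [TopologicalSpace Z] [CompactSpace Z]
    {A B : Set Z} {R : Set (Z × Z)} (hR : IsClosed R)
    (hA : ∀ z ∈ A, ∃ w ∈ B, ∀ w', (z, w') ∈ R ↔ w' = w)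
    (hB : ∀ w ∈ B, ∃ z ∈ A, ∀ z', (z', w) ∈ R ↔ z' = z) :
    ∃ g : A ≃ₜ B, ∀ z : A, ((z : Z), (g z : Z)) ∈ R := by
  choose f hfB hf using hA
  choose k hkA hk using hB
  let F : A → B := fun z => ⟨f z z.2, hfB z z.2⟩
  let G : B → A := fun w => ⟨k w w.2, hkA w w.2⟩
  have hF : Continuous F := (continuous_of_isClosed_relation hR fun z => hf z z.2).subtype_mk _
  have hG : Continuous G := (continuous_of_isClosed_relation (R := Prod.swap ⁻¹' R)
    (hR.preimage continuous_swap) fun w => hk w w.2).subtype_mk _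
  have hFR : ∀ z : A, ((z : Z), (F z : Z)) ∈ R := fun z => (hf z z.2 _).2 rfl
  have hGR : ∀ w : B, ((G w : Z), (w : Z)) ∈ R := fun w => (hk w w.2 _).2 rfl
  exact ⟨⟨⟨F, G, fun z => Subtype.ext ((hk (F z) (F z).2 _).1 (hFR z)).symm,
    fun w => Subtype.ext ((hf (G w) (G w).2 _).1 (hGR w)).symm⟩, hF, hG⟩, hFR⟩

theorem isGδ_compl_of_isSigmaCompact {Z : Type*} [TopologicalSpace Z] [T2Space Z] {F : Set Z}
    (hF : IsSigmaCompact F) : IsGδ Fᶜ := by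
  obtain ⟨K, hK, rfl⟩ := hF
  rw [compl_iUnion]
  exact IsGδ.iInter_of_isOpen fun n => (hK n).isClosed.isOpen_compl

theorem isMeagre_of_isSigmaCompact {Z : Type*} [TopologicalSpace Z] [T2Space Z] {F : Set Z}
    (hF : IsSigmaCompact F) (hd : Dense Fᶜ) : IsMeagre F :=
  residual_of_dense_Gδ (isGδ_compl_of_isSigmaCompact hF) hd

theorem isSigmaCompact_relPreimage {Z : Type*} [TopologicalSpace Z] [CompactSpace Z] [T2Space Z]
    {R : Set (Z × Z)} (hR : IsClosed R) {F : Set Z} (hF : IsSigmaCompact F) :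
    IsSigmaCompact {x | ∃ y, (x, y) ∈ R ∧ y ∈ F} := by
  obtain ⟨K, hK, rfl⟩ := hF
  have : {x | ∃ y, (x, y) ∈ R ∧ y ∈ ⋃ n, K n} = ⋃ n, Prod.fst '' (R ∩ Prod.snd ⁻¹' K n) := by
    ext x
    simp
    tauto
  rw [this]
  exact isSigmaCompact_iUnion_of_isCompact _ fun n =>
    (hR.inter ((hK n).isClosed.preimage continuous_snd)).isCompact.image continuous_fst

/-! ### Extending a homeomorphism and projecting it to the base -/

section Extension

variable {Y D : Set Cantor} {π : Cantor → Cantor}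

/-- The closure of the graph of a homeomorphism between subspaces. -/
def graphClosure (f : Y ≃ₜ Y) : Set (Cantor × Cantor) :=
  closure (range fun y : Y => ((y : Cantor), (f y : Cantor)))

/-- The points with several images under the closure of the graph. -/
def multivalued (f : Y ≃ₜ Y) : Set Cantor :=
  {x | ∃ y y', (x, y) ∈ graphClosure f ∧ (x, y') ∈ graphClosure f ∧ y ≠ y'}

/-- The points at which the closure of the graph is not bijective between points outside the
preimage of `D`. -/
def exceptional (π : Cantor → Cantor) (D : Set Cantor) (f : Y ≃ₜ Y) : Set Cantor :=
  π ⁻¹' D ∪ multivalued f ∪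
    {x | ∃ y, (x, y) ∈ graphClosure f ∧ y ∈ multivalued f.symm ∪ π ⁻¹' D}

theorem isClosed_graphClosure (f : Y ≃ₜ Y) : IsClosed (graphClosure f) := isClosed_closure

theorem mem_graphClosure (f : Y ≃ₜ Y) (y : Y) : ((y : Cantor), (f y : Cantor)) ∈ graphClosure f :=
  subset_closure ⟨y, rfl⟩

theorem swap_mem_graphClosure {f : Y ≃ₜ Y} {x y : Cantor} (h : (x, y) ∈ graphClosure f) :
    (y, x) ∈ graphClosure f.symm := by
  refine map_mem_closure (f := Prod.swap) continuous_swap h ?_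
  rintro _ ⟨z, rfl⟩
  exact ⟨f z, by simp⟩

theorem mem_graphClosure_symm {f : Y ≃ₜ Y} {x y : Cantor} :
    (y, x) ∈ graphClosure f.symm ↔ (x, y) ∈ graphClosure f :=
  ⟨swap_mem_graphClosure, swap_mem_graphClosure⟩

theorem eq_of_mem_graphClosure {f : Y ≃ₜ Y} {y : Y} {w : Cantor}
    (h : ((y : Cantor), w) ∈ graphClosure f) : w = f y := by
  refine eq_of_mem_closure_range_of_tendsto h ?_
  rw [← nhds_subtype]
  exact (continuous_subtype_val.comp f.continuous).continuousAt

theorem notMem_multivalued (f : Y ≃ₜ Y) (y : Y) : (y : Cantor) ∉ multivalued f := by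
  rintro ⟨w, w', h, h', hne⟩
  exact hne ((eq_of_mem_graphClosure h).trans (eq_of_mem_graphClosure h').symm)

theorem exists_mem_graphClosure (hY : Dense Y) (f : Y ≃ₜ Y) (x : Cantor) :
    ∃ y, (x, y) ∈ graphClosure f := by
  have hcl : IsClosed (Prod.fst '' graphClosure f) :=
    isClosedMap_fst_of_compactSpace _ (isClosed_graphClosure f)
  have hsub : Y ⊆ Prod.fst '' graphClosure f := fun y hy => ⟨_, mem_graphClosure f ⟨y, hy⟩, rfl⟩
  obtain ⟨p, hp, rfl⟩ := closure_minimal hsub hcl (hY x)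
  exact ⟨p.2, hp⟩

/-- Two distinct values differ at some coordinate, a clopen condition, so each coordinate
contributes a compact projection. -/
theorem isSigmaCompact_multivalued (f : Y ≃ₜ Y) : IsSigmaCompact (multivalued f) := by
  have : multivalued f = ⋃ n, Prod.fst '' {p : Cantor × (Cantor × Cantor) |
      ((p.1, p.2.1) ∈ graphClosure f ∧ (p.1, p.2.2) ∈ graphClosure f) ∧
        p.2.1 n ≠ p.2.2 n} := by
    ext x
    simp only [multivalued, mem_iUnion]
    constructor
    · rintro ⟨y, y', h, h', hne⟩
      obtain ⟨n, hn⟩ := Function.ne_iff.1 hne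
      exact ⟨n, (x, y, y'), ⟨⟨h, h'⟩, hn⟩, rfl⟩
    · rintro ⟨n, ⟨x', y, y'⟩, ⟨⟨h, h'⟩, hn⟩, rfl⟩
      exact ⟨y, y', h, h', fun e => hn (by rw [e])⟩
  rw [this]
  refine isSigmaCompact_iUnion_of_isCompact _ fun n => IsCompact.image ?_ continuous_fst
  refine IsClosed.isCompact (IsClosed.inter (IsClosed.inter ?_ ?_) ?_)
  · exact (isClosed_graphClosure f).preimage
      (continuous_fst.prodMk (continuous_fst.comp continuous_snd))
  · exact (isClosed_graphClosure f).preimage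
      (continuous_fst.prodMk (continuous_snd.comp continuous_snd))
  · have hc : Continuous fun p : Cantor × (Cantor × Cantor) => (p.2.1 n, p.2.2 n) := by fun_prop
    exact (isClosed_discrete {q : Bool × Bool | q.1 ≠ q.2}).preimage hc

theorem isSigmaCompact_preimage_of_countable (hπ : Continuous π) (hD : D.Countable) :
    IsSigmaCompact (π ⁻¹' D) := by
  rw [← biUnion_preimage_singleton]
  exact isSigmaCompact_biUnion hD fun d _ =>
    (isClosed_singleton.preimage hπ).isCompact.isSigmaCompact

theorem isSigmaCompact_exceptional (hπ : Continuous π) (hD : D.Countable) (f : Y ≃ₜ Y) :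
    IsSigmaCompact (exceptional π D f) := by
  have union {s t : Set Cantor} (hs : IsSigmaCompact s) (ht : IsSigmaCompact t) :
      IsSigmaCompact (s ∪ t) := by
    rw [union_eq_iUnion]
    exact isSigmaCompact_iUnion _ (by rintro (_ | _) <;> assumption)
  have h := isSigmaCompact_preimage_of_countable hπ hD
  exact union (union h (isSigmaCompact_multivalued f))
    (isSigmaCompact_relPreimage (isClosed_graphClosure f)
      (union (isSigmaCompact_multivalued f.symm) h))

theorem isMeagre_exceptional (hπ : Continuous π) (hD : D.Countable) (hW : Dense (π ⁻¹' Dᶜ))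
    (hY : Dense Y) (f : Y ≃ₜ Y) : IsMeagre (exceptional π D f) := by
  have h1 : IsMeagre (π ⁻¹' D) :=
    isMeagre_of_isSigmaCompact (isSigmaCompact_preimage_of_countable hπ hD) hW
  have h2 : IsMeagre (multivalued f) := isMeagre_of_isSigmaCompact (isSigmaCompact_multivalued f)
    (hY.mono fun y hy => notMem_multivalued f ⟨y, hy⟩)
  have h3 : IsMeagre {x | ∃ y, (x, y) ∈ graphClosure f ∧ y ∈ multivalued f.symm} := by
    refine isMeagre_of_isSigmaCompact (isSigmaCompact_relPreimage (isClosed_graphClosure f)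
      (isSigmaCompact_multivalued f.symm)) (hY.mono ?_)
    rintro y hy ⟨w, h, hw⟩
    rw [eq_of_mem_graphClosure (y := ⟨y, hy⟩) h] at hw
    exact notMem_multivalued _ _ hw
  -- If the points with a value over `d` had interior, `f` would carry a nonempty open piece of `Y`
  -- into the fibre over `d`. By density of `Y` this fibre would contain an open set, against `hW`.
  have h4 : IsMeagre (⋃ d ∈ D, {x | ∃ y, (x, y) ∈ graphClosure f ∧ π y = d}) := by
    refine isMeagre_biUnion hD fun d hd => IsNowhereDense.isMeagre ?_
    have hcl : IsClosed {x | ∃ y, (x, y) ∈ graphClosure f ∧ π y = d} := by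
      have := isClosedMap_fst_of_compactSpace _ ((isClosed_graphClosure f).inter
        ((isClosed_singleton (x := d)).preimage (hπ.comp continuous_snd)))
      convert this using 1
      ext x
      simp
    rw [hcl.isNowhereDense_iff, eq_empty_iff_forall_notMem]
    intro x hx
    obtain ⟨y, hyU, hyY⟩ := hY.inter_open_nonempty _ isOpen_interior ⟨x, hx⟩
    obtain ⟨V, hV, hVeq⟩ : ∃ V, IsOpen V ∧ Subtype.val ⁻¹' V =
        f.symm ⁻¹' (Subtype.val ⁻¹' interior {x | ∃ y, (x, y) ∈ graphClosure f ∧ π y = d}) :=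
      (isOpen_interior.preimage continuous_subtype_val).preimage f.symm.continuous
    have hsub : V ∩ Y ⊆ π ⁻¹' {d} := by
      rintro w ⟨hwV, hwY⟩
      have hw : (⟨w, hwY⟩ : Y) ∈ Subtype.val ⁻¹' V := hwV
      rw [hVeq] at hw
      obtain ⟨u, hu, hud⟩ := interior_subset hw
      rw [eq_of_mem_graphClosure hu, f.apply_symm_apply] at hud
      exact hud
    have hsub' : V ⊆ π ⁻¹' {d} := (hY.open_subset_closure_inter hV).trans
      (closure_minimal hsub (isClosed_singleton.preimage hπ))
    have hne : V.Nonempty := by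
      refine ⟨f ⟨y, hyY⟩, ?_⟩
      change f ⟨y, hyY⟩ ∈ Subtype.val ⁻¹' V
      rw [hVeq]
      simpa using hyU
    obtain ⟨w, hwV, hw⟩ := hW.inter_open_nonempty V hV hne
    exact hw (by rw [show π w = d from hsub' hwV]; exact hd)
  refine ((h1.union h2).union (h3.union h4)).mono ?_
  rintro x (h | ⟨y, h, hy | hy⟩)
  · exact .inl h
  · exact .inr (.inl ⟨y, h, hy⟩)
  · exact .inr (.inr (mem_biUnion hy ⟨y, h, rfl⟩))

/-- The exceptional set is designed symmetrically, so that its complements for `f` and `f.symm`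
correspond bijectively under the closed graph. -/
theorem exists_partner (hY : Dense Y) {f : Y ≃ₜ Y} {x : Cantor} (hx : x ∉ exceptional π D f) :
    ∃ y, y ∉ exceptional π D f.symm ∧ ∀ y', (x, y') ∈ graphClosure f ↔ y' = y := by
  simp only [exceptional, mem_union, not_or] at hx
  obtain ⟨⟨hxD, hxm⟩, hxg⟩ := hx
  obtain ⟨y, hy⟩ := exists_mem_graphClosure hY f x
  have hy' : y ∉ multivalued f.symm ∧ y ∉ π ⁻¹' D := by
    rw [← not_or]
    exact fun h => hxg ⟨y, hy, h⟩
  refine ⟨y, ?_, fun y' => ⟨fun h => ?_, fun h => h ▸ hy⟩⟩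
  · rintro ((h | h) | ⟨x', hx', h⟩)
    · exact hy'.2 h
    · exact hy'.1 h
    · have : x' = x := by
        by_contra hne
        exact hy'.1 ⟨x', x, hx', swap_mem_graphClosure hy, hne⟩
      subst this
      rcases h with h | h
      · exact hxm h
      · exact hxD h
  · by_contra hne
    exact hxm ⟨y', y, h, hy, hne⟩

/-- The set on which the homeomorphism induced on the base is defined. -/
def baseDomain (π : Cantor → Cantor) (D : Set Cantor) (f : Y ≃ₜ Y) : Set Cantor :=
  (π '' exceptional π D f)ᶜ

/-- A point that is not exceptional lies off `π ⁻¹' D`, hence is alone in its fibre. -/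
theorem mem_baseDomain (hinj : ∀ x y, π x = π y → π x ∉ D → x = y) {f : Y ≃ₜ Y} {x : Cantor}
    (hx : x ∉ exceptional π D f) : π x ∈ baseDomain π D f := by
  rintro ⟨x', hx', h⟩
  exact hx (hinj x x' h.symm (fun hD => hx (.inl (.inl hD))) ▸ hx')

theorem isGδ_baseDomain (hπ : Continuous π) (hD : D.Countable) (f : Y ≃ₜ Y) :
    IsGδ (baseDomain π D f) :=
  isGδ_compl_of_isSigmaCompact ((isSigmaCompact_exceptional hπ hD f).image hπ)

theorem isMeagre_compl_baseDomain (hπ : Continuous π) (hsurj : Function.Surjective π)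
    (hinj : ∀ x y, π x = π y → π x ∉ D → x = y) (hD : D.Countable) (hW : Dense (π ⁻¹' Dᶜ))
    (hY : Dense Y) (f : Y ≃ₜ Y) : IsMeagre (baseDomain π D f)ᶜ := by
  rw [baseDomain, compl_compl]
  refine isMeagre_of_isSigmaCompact ((isSigmaCompact_exceptional hπ hD f).image hπ) ?_
  refine (hsurj.denseRange.dense_image hπ
    (dense_of_mem_residual (isMeagre_exceptional hπ hD hW hY f))).mono ?_
  rintro _ ⟨x, hx, rfl⟩
  exact mem_baseDomain hinj hx

/-- A variant of **Lavrentieff's theorem**: `f` induces a homeomorphism between `Gδ` subspaces of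
the base. -/
theorem exists_base_homeomorph (hπ : Continuous π) (hsurj : Function.Surjective π)
    (hinj : ∀ x y, π x = π y → π x ∉ D → x = y) (hY : Dense Y) (f : Y ≃ₜ Y) :
    ∃ g : baseDomain π D f ≃ₜ baseDomain π D f.symm, ∀ z : baseDomain π D f, ∃ x y,
      π x = z ∧ π y = g z ∧ x ∉ exceptional π D f ∧ y ∉ exceptional π D f.symm ∧
        (x, y) ∈ graphClosure f := by
  have lift {f : Y ≃ₜ Y} {z : Cantor} (hz : z ∈ baseDomain π D f) :
      ∃ x, π x = z ∧ x ∉ exceptional π D f := by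
    obtain ⟨x, rfl⟩ := hsurj z
    exact ⟨x, rfl, fun h => hz ⟨x, h, rfl⟩⟩
  have key {f : Y ≃ₜ Y} : ∀ z ∈ baseDomain π D f, ∃ w ∈ baseDomain π D f.symm,
      ∀ w', (∃ x y, π x = z ∧ π y = w' ∧ (x, y) ∈ graphClosure f) ↔ w' = w := by
    intro z hz
    obtain ⟨x, rfl, hx⟩ := lift hz
    obtain ⟨y, hy, hxy⟩ := exists_partner hY hx
    refine ⟨π y, mem_baseDomain hinj hy, fun w' => ⟨?_, ?_⟩⟩
    · rintro ⟨x', y', hx', rfl, h⟩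
      have : x = x' := hinj x x' hx'.symm fun h => hx (.inl (.inl h))
      subst this
      rw [(hxy y').1 h]
    · rintro rfl
      exact ⟨x, y, rfl, rfl, (hxy y).2 rfl⟩
  have hR : IsClosed (Prod.map π π '' graphClosure f) :=
    ((isClosed_graphClosure f).isCompact.image (hπ.prodMap hπ)).isClosed
  have hmem : ∀ z w, (z, w) ∈ Prod.map π π '' graphClosure f ↔
      ∃ x y, π x = z ∧ π y = w ∧ (x, y) ∈ graphClosure f := by
    intro z w
    constructor
    · rintro ⟨⟨x, y⟩, h, e⟩
      exact ⟨x, y, congrArg Prod.fst e, congrArg Prod.snd e, h⟩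
    · rintro ⟨x, y, rfl, rfl, h⟩
      exact ⟨(x, y), h, rfl⟩
  obtain ⟨g, hg⟩ := exists_homeomorph_of_isClosed_relation hR
    (A := baseDomain π D f) (B := baseDomain π D f.symm)
    (fun z hz => by simpa only [hmem] using key z hz)
    (fun w hw => by
      obtain ⟨z, hz, h⟩ := key w hw
      refine ⟨z, hz, fun z' => ?_⟩
      rw [hmem, ← h z']
      constructor
      · rintro ⟨x, y, hx, hy, hxy⟩
        exact ⟨y, x, hy, hx, swap_mem_graphClosure hxy⟩
      · rintro ⟨y, x, hy, hx, hyx⟩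
        exact ⟨x, y, hx, hy, mem_graphClosure_symm.1 hyx⟩)
  refine ⟨g, fun z => ?_⟩
  obtain ⟨x, y, hx, hy, hxy⟩ := (hmem _ _).1 (hg z)
  exact ⟨x, y, hx, hy, fun h => z.2 ⟨x, h, hx⟩, fun h => (g z).2 ⟨y, h, hy⟩, hxy⟩

end Extension

/-! ### Baire category and `addMeager` -/

theorem mk_open_diff_isMeagre {U M : Set Cantor} (hU : IsOpen U) (hUne : U.Nonempty)
    (hM : IsMeagre M) : Cardinal.mk (U \ M : Set Cantor) = Cardinal.continuum := by
  have hC : Cardinal.mk Cantor = Cardinal.continuum := by simp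
  refine le_antisymm (hC ▸ Cardinal.mk_set_le _) ?_
  obtain ⟨t, htM, htG, htd⟩ := mem_residual.1 hM
  have hsub : U ∩ t ⊆ U \ M := fun x hx => ⟨hx.1, htM hx.2⟩
  refine le_trans ?_ (Cardinal.mk_le_mk_of_subset hsub)
  -- An uncountable Borel set is Borel isomorphic to the Cantor space, so it is enough that `U ∩ t`
  -- is uncountable.
  have hmeas : MeasurableSet (U ∩ t) := hU.measurableSet.inter htG.measurableSet
  have : StandardBorelSpace (U ∩ t : Set Cantor) := hmeas.standardBorel
  have hnc : ¬ (U ∩ t).Countable := by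
    intro hc
    refine not_isMeagre_of_isOpen hU hUne (((isMeagre_of_countable hc).union
      (show IsMeagre tᶜ from ?_)).mono fun x hx => ?_)
    · rw [IsMeagre, compl_compl]
      exact residual_of_dense_Gδ htG htd
    · by_cases hxt : x ∈ t
      · exact .inl ⟨hx, hxt⟩
      · exact .inr hxt
  have hnc' : ¬ Countable Cantor := by
    rw [← Cardinal.mk_le_aleph0_iff, hC, not_le]
    exact Cardinal.aleph0_lt_continuum
  have e : (U ∩ t : Set Cantor) ≃ᵐ Cantor :=
    PolishSpace.measurableEquivOfNotCountable (fun h => hnc h.to_set) hnc'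
  rw [Cardinal.mk_congr e.toEquiv, hC]

theorem isMeagre_iUnion_of_mk_lt_addMeager {ι : Type} (hι : Cardinal.mk ι < addMeager)
    {E : ι → Set Cantor} (hE : ∀ i, IsMeagre (E i)) : IsMeagre (⋃ i, E i) := by
  by_contra h
  refine (Cardinal.mk_range_le.trans_lt hι).not_ge (csInf_le' ⟨range E, rfl, ?_, ?_⟩)
  · rintro _ ⟨i, rfl⟩
    exact hE i
  · rwa [sUnion_range]

/-- A map that stays in the orbits of few homeomorphisms, with fewer than continuum many
exceptions, coincides with one of them on a nonempty open set. -/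
theorem exists_eqOn_open {A : Set Cantor} (hA : IsMeagre Aᶜ) {g : A → Cantor} (hg : Continuous g)
    {S : Subgroup (Cantor ≃ₜ Cantor)} (hS : Cardinal.mk S < addMeager)
    (hgS : Cardinal.mk {x : A | g x ∉ groupOrbit S (x : Cantor)} ≠ Cardinal.continuum)
    {U : Set Cantor} (hU : IsOpen U) (hUne : U.Nonempty) :
    ∃ h ∈ S, ∃ V ⊆ U, IsOpen V ∧ V.Nonempty ∧ ∀ x : A, (x : Cantor) ∈ V → g x = h x := by
  by_contra! hcon
  -- If `E h` were dense in an open set, continuity would give `g = h` there. So every `E h` is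
  -- nowhere dense, their union is meager, and the rest of `U` consists of 𝔠 exceptions.
  let E : S → Set Cantor := fun h => U ∩ Subtype.val '' {x : A | g x = h.1 x}
  have hE : ∀ h, IsMeagre (E h) := by
    intro h
    refine IsNowhereDense.isMeagre ?_
    rw [IsNowhereDense, eq_empty_iff_forall_notMem]
    intro z hz
    obtain ⟨w, hwV, hwE⟩ := mem_closure_iff.1 (interior_subset hz) _ isOpen_interior hz
    obtain ⟨x, hxV, hne⟩ := hcon h.1 h.2 (interior (closure (E h)) ∩ U) inter_subset_right
      (isOpen_interior.inter hU) ⟨w, hwV, hwE.1⟩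
    refine hne ?_
    have hcl : IsClosed {x : A | g x = h.1 x} :=
      isClosed_eq hg (h.1.continuous.comp continuous_subtype_val)
    obtain ⟨C, hC, hCeq⟩ := isClosed_induced_iff.1 hcl
    have hEC : E h ⊆ C := by
      rintro _ ⟨-, x, hx, rfl⟩
      rw [← hCeq] at hx
      exact hx
    have hx : x ∈ Subtype.val ⁻¹' C := closure_minimal hEC hC (interior_subset hxV.1)
    rwa [hCeq] at hx
  have hM : IsMeagre (Aᶜ ∪ ⋃ h, E h) := hA.union (isMeagre_iUnion_of_mk_lt_addMeager hS hE)
  refine hgS (le_antisymm ?_ ?_)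
  · refine (Cardinal.mk_set_le _).trans ((Cardinal.mk_set_le _).trans ?_)
    simp
  · rw [← mk_open_diff_isMeagre hU hUne hM, ← Cardinal.mk_image_eq Subtype.val_injective]
    refine Cardinal.mk_le_mk_of_subset ?_
    rintro x ⟨hxU, hx⟩
    rw [mem_union, not_or, notMem_compl_iff, mem_iUnion, not_exists] at hx
    refine ⟨⟨x, hx.1⟩, fun hmem => ?_, rfl⟩
    simp only [groupOrbit, groupImage, image_singleton, mem_iUnion, mem_singleton_iff,
      exists_prop] at hmem
    obtain ⟨h, hh, he⟩ := hmem
    exact hx.2 ⟨h, hh⟩ ⟨hxU, ⟨x, hx.1⟩, he, rfl⟩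

/-! ### Fibres of the splitting map -/

theorem exists_open_preimage_subset {D : Set Cantor} {π : Cantor → Cantor} (hπ : Continuous π)
    (hinj : ∀ x y, π x = π y → π x ∉ D → x = y) (hW : Dense (π ⁻¹' Dᶜ)) {O : Set Cantor}
    (hO : IsOpen O) (hOne : O.Nonempty) :
    ∃ U, IsOpen U ∧ U.Nonempty ∧ π ⁻¹' U ⊆ O := by
  -- This is the set of points whose whole fibre lies in `O`; it contains the image of any point of
  -- `O` off `π ⁻¹' D`.
  refine ⟨(π '' Oᶜ)ᶜ, (hO.isClosed_compl.isCompact.image hπ).isClosed.isOpen_compl, ?_, ?_⟩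
  · obtain ⟨x, hxO, hx⟩ := hW.inter_open_nonempty O hO hOne
    exact ⟨π x, fun ⟨y, hy, e⟩ => hy (hinj x y e.symm hx ▸ hxO)⟩
  · intro x hx
    by_contra hxO
    exact hx ⟨x, hxO, rfl⟩

theorem nonempty_preimage_homeomorph {X D : Set Cantor} {π : Cantor → Cantor} (hπ : Continuous π)
    (hsurj : Function.Surjective π) (hinj : ∀ x y, π x = π y → π x ∉ D → x = y)
    (hDX : D ⊆ Xᶜ) : Nonempty ((π ⁻¹' X : Set Cantor) ≃ₜ X) := by
  have hbij : Function.Bijective (X.restrictPreimage π) := by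
    refine ⟨fun x y h => Subtype.ext (hinj x y (congrArg Subtype.val h) fun hD => hDX hD x.2), ?_⟩
    exact hsurj.restrictPreimage X
  exact ⟨(Equiv.ofBijective _ hbij).toHomeomorphOfContinuousClosed hπ.restrictPreimage
    (hπ.isClosedMap.restrictPreimage X)⟩

/-- If the base homeomorphism induced by `f` agrees near `d` with a homeomorphism `h`, then `f`
maps the points over `d` to points over `h d`. -/
theorem apply_mem_fiber {Y D : Set Cantor} {π : Cantor → Cantor} (hπ : Continuous π)
    {f : Y ≃ₜ Y} {h : Cantor ≃ₜ Cantor} {V : Set Cantor} (hV : IsOpen V)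
    (hdense : Dense (exceptional π D f)ᶜ)
    (hfh : ∀ x y, x ∉ exceptional π D f → (x, y) ∈ graphClosure f → π x ∈ V → π y = h (π x))
    (hY : Dense Y) (k : Y) (hk : π k ∈ V) : π (f k) = h (π k) := by
  -- The point `k` may itself be exceptional, so the equation is obtained by a limit: it holds for
  -- some value on a closed set containing a dense part of `π ⁻¹' V`, and at `k ∈ Y` the only value
  -- is `f k`.
  have hcl : IsClosed (Prod.fst '' (graphClosure f ∩ {p | π p.2 = h (π p.1)})) := by
    refine isClosedMap_fst_of_compactSpace _ ((isClosed_graphClosure f).inter (isClosed_eq ?_ ?_))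
    · exact hπ.comp continuous_snd
    · exact h.continuous.comp (hπ.comp continuous_fst)
  have hsub : π ⁻¹' V ∩ (exceptional π D f)ᶜ ⊆
      Prod.fst '' (graphClosure f ∩ {p | π p.2 = h (π p.1)}) := by
    rintro x ⟨hxV, hx⟩
    obtain ⟨y, hy⟩ := exists_mem_graphClosure hY f x
    exact ⟨(x, y), ⟨hy, hfh x y hx hy hxV⟩, rfl⟩
  obtain ⟨⟨x, y⟩, ⟨hy, he⟩, rfl : x = k⟩ := closure_minimal hsub hcl
    (hdense.open_subset_closure_inter (hV.preimage hπ) hk)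
  rw [← eq_of_mem_graphClosure hy]
  exact he

end RigidComplement

/-! ### Rigidity of the complement -/

open RigidComplement Set in
theorem theorem2p1
    (X : Set RigidComplement.Cantor)
    (H : Subgroup (RigidComplement.Cantor ≃ₜ RigidComplement.Cantor))
    (D : Set RigidComplement.Cantor)
    (hDcountable : D.Countable)
    (hDdense : Dense D)
    (hDX : D ⊆ Xᶜ)
    (hDQ : D ∩ RigidComplement.Q = ∅)
    (preserve : RigidComplement.groupImage H X = X)
    (pushaway : ∀ h ∈ H, h ≠ 1 → (h '' D) ∩ D = ∅)
    (kill : ∀ A B : Set RigidComplement.Cantor, IsGδ A → IsGδ B → ∀ g : A ≃ₜ B,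
      (∀ S : Subgroup (RigidComplement.Cantor ≃ₜ RigidComplement.Cantor), S ≤ H →
        Cardinal.mk S < RigidComplement.addMeager →
        Cardinal.mk {x : A |
          (g x : RigidComplement.Cantor) ∉
            RigidComplement.groupOrbit S (x : RigidComplement.Cantor)} = Cardinal.continuum) →
      ∃ z : A, (z : RigidComplement.Cantor) ∈ X ∧ (g z : RigidComplement.Cantor) ∉ X) :
    ∃ X' : Set RigidComplement.Cantor,
      Nonempty (X' ≃ₜ X) ∧ Dense X'ᶜ ∧
        RigidComplement.IsRigid (X'ᶜ : Set RigidComplement.Cantor) := by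
  obtain ⟨π, hπ, hsurj, hinj, hsplit, hW⟩ := exists_splitting hDcountable
  have hY : Dense (π ⁻¹' X)ᶜ := by
    refine dense_iff_inter_open.2 fun O hO hOne => ?_
    obtain ⟨U, hU, hUne, hUO⟩ := exists_open_preimage_subset hπ hinj hW hO hOne
    obtain ⟨d, hdU, hdD⟩ := hDdense.inter_open_nonempty U hU hUne
    obtain ⟨x, rfl⟩ := hsurj d
    exact ⟨x, hUO hdU, hDX hdD⟩
  refine ⟨π ⁻¹' X, nonempty_preimage_homeomorph hπ hsurj hinj hDX, hY, fun f => ?_⟩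
  by_contra hf
  obtain ⟨y₀, hy₀⟩ : ∃ y, f y ≠ y := by
    by_contra! h
    exact hf (Homeomorph.ext h)
  obtain ⟨g, hg⟩ := exists_base_homeomorph (D := D) hπ hsurj hinj hY f
  obtain ⟨S, hSH, hS, hgS⟩ : ∃ S : Subgroup (Cantor ≃ₜ Cantor), S ≤ H ∧
      Cardinal.mk S < addMeager ∧
      Cardinal.mk {x : baseDomain π D f | (g x : Cantor) ∉ groupOrbit S (x : Cantor)} ≠
        Cardinal.continuum := by
    by_contra! hcon
    obtain ⟨z, hzX, hgz⟩ := kill _ _ (isGδ_baseDomain hπ hDcountable f)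
      (isGδ_baseDomain hπ hDcountable f.symm) g hcon
    obtain ⟨x, y, hx, hy, -, hye, hxy⟩ := hg z
    have hyY : y ∈ (π ⁻¹' X)ᶜ := by
      change π y ∉ X
      rwa [hy]
    have he := eq_of_mem_graphClosure (y := ⟨y, hyY⟩) (swap_mem_graphClosure hxy)
    have hxX : x ∈ (π ⁻¹' X)ᶜ := by
      rw [he]
      exact (f.symm ⟨y, hyY⟩).2
    exact hxX (by rwa [mem_preimage, hx])
  -- Since `f` moves `y₀`, the closed graph misses the diagonal near `y₀`. Working over this open
  -- set will exclude `h = 1`.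
  obtain ⟨O, hO, hOne, hOdiag⟩ : ∃ O : Set Cantor, IsOpen O ∧ O.Nonempty ∧
      ∀ x ∈ O, (x, x) ∉ graphClosure f :=
    ⟨(fun x => (x, x)) ⁻¹' (graphClosure f)ᶜ,
      (isClosed_graphClosure f).isOpen_compl.preimage (by fun_prop),
      ⟨y₀, fun h => hy₀ (Subtype.ext (eq_of_mem_graphClosure h).symm)⟩, fun _ hx => hx⟩
  obtain ⟨U, hU, hUne, hUO⟩ := exists_open_preimage_subset hπ hinj hW hO hOne
  have hmeagre := isMeagre_compl_baseDomain hπ hsurj hinj hDcountable hW hY f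
  obtain ⟨h, hhS, V, hVU, hV, hVne, hgh⟩ := exists_eqOn_open hmeagre
    (continuous_subtype_val.comp g.continuous) hS hgS hU hUne
  have hdense : Dense (exceptional π D f)ᶜ :=
    dense_of_mem_residual (isMeagre_exceptional hπ hDcountable hW hY f)
  have hfh : ∀ x y, x ∉ exceptional π D f → (x, y) ∈ graphClosure f → π x ∈ V →
      π y = h (π x) := by
    intro x y hx hxy hxV
    obtain ⟨x', y', hx', hy', -, -, hxy'⟩ := hg ⟨π x, mem_baseDomain hinj hx⟩
    have e : x = x' := hinj x x' hx'.symm fun hD => hx (.inl (.inl hD))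
    subst e
    have e : y = y' := by
      by_contra hne
      exact hx (.inl (.inr ⟨y, y', hxy, hxy', hne⟩))
    subst e
    rw [hy']
    exact hgh ⟨π x, mem_baseDomain hinj hx⟩ hxV
  have hne : h ≠ 1 := by
    rintro rfl
    obtain ⟨x, hxV, hx⟩ := hdense.inter_open_nonempty _ (hV.preimage hπ) (hVne.preimage hsurj)
    obtain ⟨y, hy⟩ := exists_mem_graphClosure hY f x
    have hyx : π y = π x := hfh x y hx hy hxV
    rw [← hinj x y hyx.symm fun hD => hx (.inl (.inl hD))] at hy
    exact hOdiag x (hUO (hVU hxV)) hy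
  obtain ⟨d, hdV, hdD⟩ := hDdense.inter_open_nonempty V hV hVne
  obtain ⟨k, l, hkl, hk, hl⟩ := hsplit d hdD
  have hkY : k ∈ (π ⁻¹' X)ᶜ := fun hX => hDX hdD (hk ▸ hX)
  have hlY : l ∈ (π ⁻¹' X)ᶜ := fun hX => hDX hdD (hl ▸ hX)
  have h1 := apply_mem_fiber hπ hV hdense hfh hY ⟨k, hkY⟩ (by rwa [hk])
  have h2 := apply_mem_fiber hπ hV hdense hfh hY ⟨l, hlY⟩ (by rwa [hl])
  simp only [hk, hl] at h1 h2
  -- Off `D` fibres are single points, so the two points `k`, `l` over `d` get the same image.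
  have hhd : h d ∉ D := fun hD => by
    have : h d ∈ (h '' D) ∩ D := ⟨⟨d, hdD, rfl⟩, hD⟩
    rw [pushaway h (hSH hhS) hne] at this
    exact this
  have hfe := hinj _ _ (h1.trans h2.symm) (h1 ▸ hhd)
  exact hkl (congrArg Subtype.val (f.injective (Subtype.ext hfe)))
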